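/- Let $(\mathcal X,\mathcal B)$ be a measurable space and let $X_1,X_2,\dots$ be independent random elements of $\mathcal X$ with common distribution $F$. For each $N$ let $T_N=T_N(X_1,\dots,X_N)$ be a real statistic, invariant under permutations of the data. Let $\theta\in\mathbb R$, let $\alpha$ and $\beta$ be measurable functions on $\mathcal X$ and $\mathcal X\times\mathcal X$, with $\beta$ symmetric, and define the remainder $R_N$ by $$T_N=\theta+N^{-1}\sum_{i=1}^N\alpha(X_i)+N^{-2}\sum_{1\le i<j\le N}\beta(X_i,X_j)+R_N .$$ For each $N$ let the data be divided (in any way not depending on the observed values) into $K=K(N)$ blocks $\{X_{k,1},\dots,X_{k,n_k}\}$, $k=1,\dots,K$, of sizes $n_k=n_k(N)$ with $\sum_k n_k=N$. Let $T_{N,K}^{(k)}$ be a permutation-invariant statistic of the $k$-th block (for example $T_{n_k}$ applied to the $k$-th block), with remainder $R_{N,K}^{(k)}$ defined by $$T_{N,K}^{(k)}=\theta+n_k^{-1}\sum_{i=1}^{n_k}\alpha(X_{k,i})+n_k^{-2}\sum_{1\le i<j\le n_k}\beta(X_{k,i},X_{k,j})+R_{N,K}^{(k)},$$ and let $T_{N,K}=N^{-1}\sum_{k=1}^K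 n_kT_{N,K}^{(k)}$ be the distributed statistic. Assume: 1. $\mathrm E\{\alpha(X_1)\}=0$ and $\mathrm{Var}\{\alpha(X_1)\}=\sigma_\alpha^2$ with $0<\sigma_\alpha<\infty$; $\mathrm E\{\beta(X_1,X_2)\mid X_1\}=0$ almost surely and $\mathrm{Var}\{\beta(X_1,X_2)\}<\infty$. 2. There are constants $0<c_1\le c_2<\infty$ with $c_1\le n_{k_1}/n_{k_2}\le c_2$ for all $k_1,k_2\le K$ and all large $N$, and $K/N\to0$ as $N\to\infty$. 3. For some $b_1\in\mathbb R$, $\tau_1\ge1$ and $\tau_2>1$, as $N\to\infty$, $\mathrm E(R_N)=b_1N^{-\tau_1}+o(N^{-\tau_1})$ and $\mathrm{Var}(R_N)=o(N^{-\tau_2})$; and, uniformly in $k=1,\dots,K$, $\mathrm E(R_{N,K}^{(k)})=b_{1,k}n_k^{-\tau_1}+o(n_k^{-\tau_1})$ and $\mathrm{Var}(R_{N,K}^{(k)})=o(n_k^{-\tau_2})$, where the real numbers $b_{1,k}$ (which may depend on $N$) are bounded uniformly in $k$ and $N$. In particular these second moments are finite for all large $N$. 4. $\mathrm E|\alpha(X_1)|^{2+\delta}<\infty$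 for some $0<\delta\le1$. 5. $K=O(N^{\tau'})$ for some constant $\tau'$ with $0<\tau'<1-1/(2\tau_1)$. Then, as $N\to\infty$, $$\sup_{x\in\mathbb R}\Big|\mathrm P\{N^{1/2}\sigma_\alpha^{-1}(T_{N,K}-\theta)\le x\}-\mathrm P\{N^{1/2}\sigma_\alpha^{-1}(T_N-\theta)\le x\}\Big|\to0 .$$ -/

import Mathlib

open MeasureTheory ProbabilityTheory Filter Topology Asymptotics

noncomputable section

/-- A division of a data set of size `N` into `K` blocks: the block sizes `n_k`, and a bijection
telling which observation is the `i`-th element of the `k`-th block. In particular the sizes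
sum to `N`. -/
structure BlockDivision (N K : ℕ) where
  size : Fin K → ℕ
  index : (Σ k : Fin K, Fin (size k)) ≃ Fin N

/-- The `k`-th data block `(X_{k,1}, …, X_{k,n_k})` of a data set `x`. -/
def BlockDivision.block {N K : ℕ} {𝒳 : Type*} (D : BlockDivision N K) (x : Fin N → 𝒳)
    (k : Fin K) : Fin (D.size k) → 𝒳 :=
  fun i => x (D.index ⟨k, i⟩)

/-- The data set of the first `N` terms of a sequence of random elements. -/
def sample {Ω 𝒳 : Type*} (X : ℕ → Ω → 𝒳) (N : ℕ) (ω : Ω) : Fin N → 𝒳 :=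
  fun i => X i ω

/-- A symmetric statistic of `m` observations: measurable, and invariant under permutations of
the data. -/
structure IsSymmetricStatistic {𝒳 : Type*} [MeasurableSpace 𝒳] {m : ℕ}
    (S : (Fin m → 𝒳) → ℝ) : Prop where
  measurable : Measurable S
  perm_invariant : ∀ (π : Equiv.Perm (Fin m)) (x : Fin m → 𝒳), S (x ∘ π) = S x

/-- The remainder `R` of the statistic `S` of `m` observations in the expansion
`S = θ + m⁻¹ ∑ᵢ α(xᵢ) + m⁻² ∑_{i<j} β(xᵢ, xⱼ) + R`. -/
def remainder {𝒳 : Type*} (θ : ℝ) (α : 𝒳 → ℝ) (β : 𝒳 → 𝒳 → ℝ) {m : ℕ}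
    (S : (Fin m → 𝒳) → ℝ) (x : Fin m → 𝒳) : ℝ :=
  S x - (θ + (m : ℝ)⁻¹ * ∑ i, α (x i)
    + ((m : ℝ) ^ 2)⁻¹ * ∑ i, ∑ j ∈ Finset.Ioi i, β (x i) (x j))

/-- The distributed statistic `T_{N,K} = N⁻¹ ∑ₖ n_k T_{N,K}^{(k)}`, where the block-wise statistic
`T_{N,K}^{(k)}` is `S k` evaluated at the `k`-th block. -/
def distributedStatistic {N K : ℕ} {𝒳 : Type*} (D : BlockDivision N K)
    (S : (k : Fin K) → (Fin (D.size k) → 𝒳) → ℝ) (x : Fin N → 𝒳) : ℝ :=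
  (N : ℝ)⁻¹ * ∑ k, (D.size k : ℝ) * S k (D.block x k)

/-- First two moments of the full-sample remainder:
`E R_N = b N^{-τ₁} + o(N^{-τ₁})` and `Var R_N = o(N^{-τ₂})`. -/
structure RemainderMoments {Ω : Type*} [MeasurableSpace Ω] (P : Measure Ω)
    (R : ℕ → Ω → ℝ) (b τ₁ τ₂ : ℝ) : Prop where
  memLp : ∀ᶠ N in atTop, MemLp (R N) 2 P
  mean : (fun N : ℕ => (∫ ω, R N ω ∂P) - b * (N : ℝ) ^ (-τ₁)) =o[atTop]
    fun N : ℕ => (N : ℝ) ^ (-τ₁)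
  variance : (fun N : ℕ => variance (R N) P) =o[atTop] fun N : ℕ => (N : ℝ) ^ (-τ₂)

/-- First two moments of the block-wise remainders:
`E R_{N,K}^{(k)} = b_k n_k^{-τ₁} + o(n_k^{-τ₁})` and `Var R_{N,K}^{(k)} = o(n_k^{-τ₂})`,
where the `b_k` are bounded and the small-o terms are uniform over the blocks. -/
structure BlockRemainderMoments {Ω : Type*} [MeasurableSpace Ω] (P : Measure Ω) {K : ℕ → ℕ}
    (n : (N : ℕ) → Fin (K N) → ℕ) (R : (N : ℕ) → Fin (K N) → Ω → ℝ)
    (b : (N : ℕ) → Fin (K N) → ℝ) (τ₁ τ₂ : ℝ) : Prop where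
  memLp : ∀ᶠ N in atTop, ∀ k, MemLp (R N k) 2 P
  bounded : ∃ B : ℝ, ∀ N k, |b N k| ≤ B
  mean : ∀ ε : ℝ, 0 < ε → ∀ᶠ N in atTop, ∀ k,
    |(∫ ω, R N k ω ∂P) - b N k * (n N k : ℝ) ^ (-τ₁)| ≤ ε * (n N k : ℝ) ^ (-τ₁)
  variance : ∀ ε : ℝ, 0 < ε → ∀ᶠ N in atTop, ∀ k,
    variance (R N k) P ≤ ε * (n N k : ℝ) ^ (-τ₂)

/-- The Kolmogorov distance `sup_x |P(Y ≤ x) - P(Z ≤ x)|` between the laws of two real random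
variables. The supremum is over a set bounded by `1` when `P` is a probability measure. -/
def kolmogorovDist {Ω : Type*} [MeasurableSpace Ω] (P : Measure Ω) (Y Z : Ω → ℝ) : ℝ :=
  ⨆ x : ℝ, |P.real {ω | Y ω ≤ x} - P.real {ω | Z ω ≤ x}|

end

/-! Both standardized statistics converge in law to the standard normal, so they are close to each
other. The limit has no atoms, hence by Pólya's theorem each distribution function converges to it
uniformly, and the Kolmogorov distance vanishes by the triangle inequality
(`tendsto_kolmogorovDist_zero`).

For the distributed statistic, weighting block `k` by `n_k` makes the linear terms add up to the
full-sample sum of the `α(X_i)`, whatever the division (`sub_eq_add_remainder`). The central limit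
theorem and Slutsky's lemma then reduce the claim to two terms, both handled by mean and variance.

The quadratic term has mean zero. Degeneracy makes the values of `β` at distinct pairs orthogonal,
and a block has at most `n_k ^ 2` pairs of weight `1 / n_k`, so the variance is at most `K Var β`.
After division by `N` it is `O(K / N)`.

The block remainders are independent, so their weighted sum has variance `o(∑ n_k ^ (2 - τ₂))`,
which is `o(N)`. Their biases add up: with `n_k ≥ c N / K` the total is `O(K ^ τ₁ N ^ (1 - τ₁))`,
which is `o(√N)` exactly under the growth condition on `K`.

The full-sample statistic is the case `K = 1` of the same result. -/

/-! ### Uniform convergence of distribution functions -/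

/-- **Pólya's theorem**: pointwise convergence of distribution functions to a continuous
distribution function is uniform. -/
theorem eventually_forall_abs_sub_le_of_tendsto_cdf {F : ℕ → ℝ → ℝ} {G : ℝ → ℝ}
    (hF_mono : ∀ n, Monotone (F n)) (hF_nonneg : ∀ n x, 0 ≤ F n x) (hF_le : ∀ n x, F n x ≤ 1)
    (hG_mono : Monotone G) (hG_cont : Continuous G) (hG_bot : Tendsto G atBot (𝓝 0))
    (hG_top : Tendsto G atTop (𝓝 1)) (h : ∀ x, Tendsto (fun n => F n x) atTop (𝓝 (G x)))
    {ε : ℝ} (hε : 0 < ε) : ∀ᶠ n in atTop, ∀ x, |F n x - G x| ≤ ε := by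
  obtain ⟨m, hm⟩ := exists_nat_gt (2 / ε)
  have hm0 : (0 : ℝ) < m := lt_trans (by positivity) hm
  have hmε : 2 / (m : ℝ) ≤ ε := by
    rw [div_lt_iff₀ hε] at hm
    rw [div_le_iff₀ hm0]
    linarith
  have hquant : ∀ y : ℝ, 0 < y → y < 1 → ∃ t, G t = y := fun y hy0 hy1 =>
    mem_range_of_exists_le_of_exists_ge hG_cont
      (((tendsto_order.1 hG_bot).2 y hy0).exists.imp fun _ h => h.le)
      (((tendsto_order.1 hG_top).1 y hy1).exists.imp fun _ h => h.le)
  -- The grid consists of quantiles of `G` at levels `i / m`, `0 < i < m`. Outside this range the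
  -- point is a dummy, there only so that `choose` gives a total function.
  have hq : ∀ i : ℕ, ∃ t, 0 < i → i < m → G t = i / m := by
    intro i
    by_cases hi : 0 < i ∧ i < m
    · obtain ⟨t, ht⟩ := hquant (i / m) (div_pos (by exact_mod_cast hi.1) hm0)
        ((div_lt_one hm0).2 (by exact_mod_cast hi.2))
      exact ⟨t, fun _ _ => ht⟩
    · exact ⟨0, fun h1 h2 => absurd ⟨h1, h2⟩ hi⟩
  choose t ht using hq
  have hev : ∀ᶠ n in atTop, ∀ i ∈ Finset.range m, |F n (t i) - G (t i)| < 1 / m :=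
    (Finset.eventually_all _).2 fun i _ =>
      (Metric.tendsto_nhds.1 (h (t i))) (1 / m) (by positivity)
  have hG0 : ∀ x, 0 ≤ G x := fun x => hG_mono.le_of_tendsto hG_bot x
  have hG1 : ∀ x, G x ≤ 1 := fun x => hG_mono.ge_of_tendsto hG_top x
  filter_upwards [hev] with n hn x
  have hgx : (0 : ℝ) ≤ m * G x := mul_nonneg hm0.le (hG0 x)
  have h2m : 2 / (m : ℝ) = 1 / m + 1 / m := by ring
  have hm1 : 0 < 1 / (m : ℝ) := by positivity
  rw [abs_le]
  constructor
  -- The ceiling minus one is the largest level strictly below `m * G x`. Strictness matters: a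
  -- monotone `G` reflects only strict inequalities. At level `0` there is no grid point, and `0 ≤ F
  -- n x` takes its place.
  · rcases Nat.eq_zero_or_pos (⌈(m : ℝ) * G x⌉₊ - 1) with h0 | h0
    · have h1 : (m : ℝ) * G x ≤ 1 := by
        have : ⌈(m : ℝ) * G x⌉₊ ≤ 1 := by omega
        simpa using Nat.ceil_le.1 this
      have : G x ≤ 1 / m := by rw [le_div_iff₀ hm0]; linarith
      linarith [hF_nonneg n x]
    · obtain ⟨i, hi⟩ : ∃ i, ⌈(m : ℝ) * G x⌉₊ = i + 1 := ⟨⌈(m : ℝ) * G x⌉₊ - 1, by omega⟩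
      have hi0 : 0 < i := by omega
      have hlt : (i : ℝ) < m * G x := Nat.lt_ceil.1 (by omega)
      have hle : (m : ℝ) * G x ≤ i + 1 := by
        have := Nat.le_ceil ((m : ℝ) * G x)
        rw [hi] at this
        exact_mod_cast this
      have him : i < m := by
        have : (i : ℝ) < m := by nlinarith [hG1 x]
        exact_mod_cast this
      have hti := ht i hi0 him
      have htx : t i < x := hG_mono.reflect_lt (by rw [hti, div_lt_iff₀ hm0]; linarith)
      have h1 := (abs_lt.1 (hn i (Finset.mem_range.2 him))).1
      have h2 := hF_mono n htx.le
      have h3 : G x ≤ i / m + 1 / m := by rw [← add_div, le_div_iff₀ hm0]; linarith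
      rw [hti] at h1
      linarith
  -- The smallest level strictly above `m * G x`; when it reaches `m`, the bound `F n x ≤ 1`
  -- replaces the grid point.
  · set i := ⌊(m : ℝ) * G x⌋₊ + 1 with hi
    have hlt : (m : ℝ) * G x < i := by rw [hi]; exact_mod_cast Nat.lt_floor_add_one _
    have hle : (i : ℝ) ≤ m * G x + 1 := by
      rw [hi]; push_cast
      linarith [Nat.floor_le hgx]
    rcases lt_or_ge i m with him | him
    · have hti := ht i (by omega) him
      have htx : x < t i := hG_mono.reflect_lt (by rw [hti, lt_div_iff₀ hm0]; linarith)
      have h1 := (abs_lt.1 (hn i (Finset.mem_range.2 him))).2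
      have h2 := hF_mono n htx.le
      have h3 : i / m ≤ G x + 1 / m := by
        rw [div_le_iff₀ hm0, add_mul, one_div_mul_cancel hm0.ne']; linarith
      rw [hti] at h1
      linarith
    · have : (m : ℝ) ≤ i := by exact_mod_cast him
      have h3 : 1 ≤ G x + 1 / m := by
        rw [← mul_le_mul_iff_of_pos_right hm0, add_mul, one_div_mul_cancel hm0.ne']; linarith
      linarith [hF_le n x]

theorem MeasureTheory.TendstoInMeasure.add_zero_limits {Ω : Type*} [MeasurableSpace Ω]
    {P : Measure Ω} {Y Z : ℕ → Ω → ℝ}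
    (hY : TendstoInMeasure P Y atTop 0) (hZ : TendstoInMeasure P Z atTop 0) :
    TendstoInMeasure P (Y + Z) atTop 0 := by
  rw [tendstoInMeasure_iff_norm] at *
  intro ε hε
  have h := (hY (ε / 2) (half_pos hε)).add (hZ (ε / 2) (half_pos hε))
  rw [add_zero] at h
  refine tendsto_of_tendsto_of_tendsto_of_le_of_le tendsto_const_nhds h (fun _ => zero_le)
    fun n => (measure_mono fun ω hω => ?_).trans (measure_union_le _ _)
  simp only [Pi.zero_apply, sub_zero, Real.norm_eq_abs, Set.mem_ofPred_eq, Set.mem_union,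
    Pi.add_apply] at hω ⊢
  by_contra! hc
  linarith [abs_add_le (Y n ω) (Z n ω)]

/-! ### Kolmogorov distance and convergence in probability -/

section AsymptoticEquivalence

variable {Ω : Type*} [MeasurableSpace Ω] {P : Measure Ω} [IsProbabilityMeasure P]

/-- Two sequences of real random variables that converge in distribution to the same variable
with an atomless law are asymptotically equal in Kolmogorov distance. -/
theorem tendsto_kolmogorovDist_zero {Ω' : Type*} [MeasurableSpace Ω'] {P' : Measure Ω'}
    [IsProbabilityMeasure P'] {Y Z : ℕ → Ω → ℝ} {W : Ω' → ℝ} [NullSingletonClass (P'.map W)]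
    (hY : TendstoInDistribution Y atTop W (fun _ => P) P')
    (hZ : TendstoInDistribution Z atTop W (fun _ => P) P') :
    Tendsto (fun n => kolmogorovDist P (Y n) (Z n)) atTop (𝓝 0) := by
  have hW := hY.aemeasurable_limit
  have : IsProbabilityMeasure (P'.map W) := Measure.isProbabilityMeasure_map hW
  have key : ∀ V : ℕ → Ω → ℝ, TendstoInDistribution V atTop W (fun _ => P) P' →
      ∀ ε : ℝ, 0 < ε →
        ∀ᶠ n in atTop, ∀ x, |P.real {ω | V n ω ≤ x} - cdf (P'.map W) x| ≤ ε := by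
    intro V hV ε hε
    refine eventually_forall_abs_sub_le_of_tendsto_cdf (F := fun n x => P.real {ω | V n ω ≤ x})
      (fun n x y hxy => measureReal_mono fun ω (h : V n ω ≤ x) => h.trans hxy)
      (fun _ _ => measureReal_nonneg) (fun _ _ => measureReal_le_one) (monotone_cdf _)
      ?_ (tendsto_cdf_atBot _) (tendsto_cdf_atTop _) ?_ hε
    -- The jump of the distribution function at `x` is the mass of `{x}`, which is zero.
    · refine continuous_iff_continuousAt.2 fun x => ?_
      rw [(monotone_cdf _).continuousAt_iff_leftLim_eq_rightLim, StieltjesFunction.rightLim_eq]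
      have h1 := StieltjesFunction.measure_singleton (cdf (P'.map W)) x
      rw [measure_cdf, measure_singleton, eq_comm, ENNReal.ofReal_eq_zero] at h1
      exact le_antisymm ((monotone_cdf _).leftLim_le le_rfl) (by linarith)
    · intro x
      have h1 := ProbabilityMeasure.tendsto_measure_of_null_frontier_of_tendsto' hV.tendsto
        (E := Set.Iic x) (by simp)
      have h2 := (ENNReal.tendsto_toReal (measure_ne_top (P'.map W) (Set.Iic x))).comp h1
      rw [cdf_eq_real]
      refine h2.congr fun n => ?_
      simp only [Function.comp_apply, ProbabilityMeasure.coe_mk]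
      rw [Measure.map_apply_of_aemeasurable (hV.forall_aemeasurable n) measurableSet_Iic]
      rfl
  rw [Metric.tendsto_nhds]
  intro ε hε
  filter_upwards [key Y hY (ε / 3) (by positivity), key Z hZ (ε / 3) (by positivity)] with n h1 h2
  have hb : kolmogorovDist P (Y n) (Z n) ≤ 2 * (ε / 3) := by
    refine ciSup_le fun x => ?_
    have h3 := abs_le.1 (h1 x)
    have h4 := abs_le.1 (h2 x)
    rw [abs_le]
    constructor <;> linarith
  have h0 : 0 ≤ kolmogorovDist P (Y n) (Z n) := Real.iSup_nonneg fun x => abs_nonneg _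
  rw [Real.dist_0_eq_abs, abs_of_nonneg h0]
  linarith

/-- Random variables whose mean and variance tend to zero tend to zero in probability. -/
theorem tendstoInMeasure_zero_of_mean_of_variance {Y : ℕ → Ω → ℝ}
    (hY : ∀ᶠ n in atTop, MemLp (Y n) 2 P)
    (hmean : Tendsto (fun n => ∫ ω, Y n ω ∂P) atTop (𝓝 0))
    (hvar : Tendsto (fun n => Var[Y n; P]) atTop (𝓝 0)) :
    TendstoInMeasure P Y atTop 0 := by
  rw [tendstoInMeasure_iff_norm]
  intro ε hε
  have hlim : Tendsto (fun n => ENNReal.ofReal (Var[Y n; P] / (ε / 2) ^ 2)) atTop (𝓝 0) := by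
    have := ENNReal.tendsto_ofReal (hvar.div_const ((ε / 2) ^ 2))
    simpa using this
  refine tendsto_of_tendsto_of_tendsto_of_le_of_le' tendsto_const_nhds hlim
    (Eventually.of_forall fun _ => zero_le) ?_
  filter_upwards [hY, (Metric.tendsto_nhds.1 hmean) (ε / 2) (by positivity)] with n hn hm
  -- Once the mean is below `ε / 2`, a value of size `ε` deviates from the mean by at least `ε / 2`,
  -- and Chebyshev's inequality applies.
  refine (measure_mono fun ω hω => ?_).trans (meas_ge_le_variance_div_sq hn (half_pos hε))
  rw [Real.dist_0_eq_abs] at hm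
  simp only [Pi.zero_apply, sub_zero, Real.norm_eq_abs, Set.mem_ofPred_eq] at hω ⊢
  linarith [abs_sub_abs_le_abs_sub (Y n ω) (∫ x, Y n x ∂P)]

end AsymptoticEquivalence

/-! ### Orthogonality of degenerate kernels -/

section DegenerateKernel

variable {Ω 𝒳 : Type*} [MeasurableSpace Ω] [MeasurableSpace 𝒳] {P : Measure Ω}
  [IsProbabilityMeasure P] {F : Measure 𝒳} {X : ℕ → Ω → 𝒳} {β : 𝒳 → 𝒳 → ℝ}

theorem map_prodMk_eq_prod (hX_meas : ∀ i, Measurable (X i)) (hX_law : ∀ i, P.map (X i) = F)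
    (hX_indep : iIndepFun X P) {i j : ℕ} (hij : i ≠ j) :
    P.map (fun ω => (X i ω, X j ω)) = F.prod F := by
  rw [(indepFun_iff_map_prod_eq_prod_map_map (hX_meas i).aemeasurable
    (hX_meas j).aemeasurable).1 (hX_indep.indepFun hij), hX_law, hX_law]

theorem memLp_kernel (hX_meas : ∀ i, Measurable (X i)) (hX_law : ∀ i, P.map (X i) = F)
    (hX_indep : iIndepFun X P) (hβ_meas : Measurable (Function.uncurry β))
    (hβ_memLp : MemLp (fun ω => β (X 0 ω) (X 1 ω)) 2 P) {i j : ℕ} (hij : i ≠ j) :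
    MemLp (fun ω => β (X i ω) (X j ω)) 2 P := by
  have h : ∀ {i j : ℕ}, i ≠ j →
      (MemLp (Function.uncurry β) 2 (F.prod F) ↔ MemLp (fun ω => β (X i ω) (X j ω)) 2 P) := by
    intro i j hij
    rw [← map_prodMk_eq_prod hX_meas hX_law hX_indep hij,
      memLp_map_measure_iff hβ_meas.aestronglyMeasurable
        ((hX_meas i).prodMk (hX_meas j)).aemeasurable]
    rfl
  exact (h hij).1 ((h zero_ne_one).2 hβ_memLp)

theorem variance_kernel (hX_meas : ∀ i, Measurable (X i)) (hX_law : ∀ i, P.map (X i) = F)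
    (hX_indep : iIndepFun X P) (hβ_meas : Measurable (Function.uncurry β)) {i j : ℕ}
    (hij : i ≠ j) :
    Var[fun ω => β (X i ω) (X j ω); P] = Var[fun ω => β (X 0 ω) (X 1 ω); P] := by
  have h : ∀ {i j : ℕ}, i ≠ j →
      Var[Function.uncurry β; F.prod F] = Var[fun ω => β (X i ω) (X j ω); P] := by
    intro i j hij
    rw [← map_prodMk_eq_prod hX_meas hX_law hX_indep hij,
      variance_map hβ_meas.aemeasurable ((hX_meas i).prodMk (hX_meas j)).aemeasurable]
    rfl
  rw [← h hij, ← h zero_ne_one]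

/-- Degeneracy of the kernel, as a statement about its marginal integrals. -/
theorem ae_integral_kernel_eq_zero (hX_meas : ∀ i, Measurable (X i))
    (hX_law : ∀ i, P.map (X i) = F) (hX_indep : iIndepFun X P)
    (hβ_meas : Measurable (Function.uncurry β))
    (hβ_memLp : MemLp (fun ω => β (X 0 ω) (X 1 ω)) 2 P)
    (hβ_cond : P[fun ω => β (X 0 ω) (X 1 ω) | MeasurableSpace.comap (X 0) inferInstance]
      =ᵐ[P] 0) : ∀ᵐ x ∂F, ∫ y, β x y ∂F = 0 := by
  have : IsProbabilityMeasure F := hX_law 0 ▸ Measure.isProbabilityMeasure_map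
    (hX_meas 0).aemeasurable
  have hmap := map_prodMk_eq_prod hX_meas hX_law hX_indep zero_ne_one
  have hpair : Measurable fun ω => (X 0 ω, X 1 ω) := (hX_meas 0).prodMk (hX_meas 1)
  have hint : Integrable (fun ω => β (X 0 ω) (X 1 ω)) P := hβ_memLp.integrable (by norm_num)
  have hintF : Integrable (Function.uncurry β) (F.prod F) := by
    rw [← hmap]
    exact (integrable_map_measure hβ_meas.aestronglyMeasurable hpair.aemeasurable).2 hint
  -- The integral of the marginal over `s` is the integral of `β` over `s × univ`, that is, over an
  -- event of the σ-algebra of `X 0`, where the conditional expectation vanishes.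
  refine hintF.integral_prod_left.ae_eq_zero_of_forall_setIntegral_eq_zero fun s hs _ => ?_
  have h1 : ∫ ω in X 0 ⁻¹' s, β (X 0 ω) (X 1 ω) ∂P = 0 := by
    rw [← setIntegral_condExp (hX_meas 0).comap_le hint ⟨s, hs, rfl⟩]
    exact (integral_congr_ae (ae_restrict_of_ae hβ_cond)).trans (by simp)
  have h2 := setIntegral_prod (s := s) (t := Set.univ) (μ := F) (ν := F) (Function.uncurry β)
    hintF.integrableOn
  rw [← hmap, setIntegral_map (hs.prod MeasurableSet.univ) hβ_meas.aestronglyMeasurable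
    hpair.aemeasurable, Measure.restrict_univ] at h2
  rw [← h1]
  refine h2.symm.trans ?_
  congr 2
  ext ω
  simp

/-- A degenerate symmetric kernel, evaluated at an observation that is independent of `W`, is
orthogonal to every function of `W`. -/
theorem integral_kernel_mul_eq_zero {𝒲 : Type*} [MeasurableSpace 𝒲] {Y : Ω → 𝒳} {W : Ω → 𝒲}
    {u : 𝒲 → 𝒳} {g : 𝒲 → ℝ} (hY : Measurable Y) (hW : Measurable W) (hu : Measurable u)
    (hg : Measurable g) (hYW : IndepFun Y W P) (hY_law : P.map Y = F)
    (hu_law : P.map (u ∘ W) = F) (hβ_meas : Measurable (Function.uncurry β))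
    (hβ_symm : ∀ x y, β x y = β y x) (hβ_zero : ∀ᵐ x ∂F, ∫ y, β x y ∂F = 0)
    (hint : Integrable (fun ω => β (Y ω) (u (W ω)) * g (W ω)) P) :
    ∫ ω, β (Y ω) (u (W ω)) * g (W ω) ∂P = 0 := by
  have : IsProbabilityMeasure F := hY_law ▸ Measure.isProbabilityMeasure_map hY.aemeasurable
  have : IsProbabilityMeasure (P.map W) := Measure.isProbabilityMeasure_map hW.aemeasurable
  have hmap : P.map (fun ω => (Y ω, W ω)) = F.prod (P.map W) := by
    rw [(indepFun_iff_map_prod_eq_prod_map_map hY.aemeasurable hW.aemeasurable).1 hYW, hY_law]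
  let f : 𝒳 × 𝒲 → ℝ := fun p => β p.1 (u p.2) * g p.2
  have hf : Measurable f :=
    (hβ_meas.comp (measurable_fst.prodMk (hu.comp measurable_snd))).mul (hg.comp measurable_snd)
  have hpair : Measurable fun ω => (Y ω, W ω) := hY.prodMk hW
  have hfint : Integrable f (F.prod (P.map W)) := by
    rw [← hmap]
    exact (integrable_map_measure hf.aestronglyMeasurable hpair.aemeasurable).2 hint
  have h1 : ∫ ω, β (Y ω) (u (W ω)) * g (W ω) ∂P = ∫ p, f p ∂(F.prod (P.map W)) := by
    rw [← hmap, integral_map hpair.aemeasurable hf.aestronglyMeasurable]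
  have hzero : ∀ᵐ w ∂(P.map W), ∫ y, β (u w) y ∂F = 0 := by
    rw [← hu_law, ← Measure.map_map hu hW] at hβ_zero
    have := ae_of_ae_map hu.aemeasurable hβ_zero
    rwa [Measure.map_map hu hW, hu_law] at this
  rw [h1, integral_prod_symm _ hfint]
  refine integral_eq_zero_of_ae ?_
  filter_upwards [hzero] with w hw
  simp only [f, integral_mul_const, Pi.zero_apply]
  simp_rw [fun x => hβ_symm x (u w), hw, zero_mul]

/-- The index `i` occurs only once, so `X i` is independent of the other observations jointly and
can be integrated out first. Collecting those indices in a finset allows `j` to coincide with `k` or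
`l`. -/
theorem integral_kernel_mul_kernel_eq_zero_of_ne (hX_meas : ∀ i, Measurable (X i))
    (hX_law : ∀ i, P.map (X i) = F) (hX_indep : iIndepFun X P)
    (hβ_meas : Measurable (Function.uncurry β)) (hβ_symm : ∀ x y, β x y = β y x)
    (hβ_zero : ∀ᵐ x ∂F, ∫ y, β x y ∂F = 0)
    (hβ_memLp : MemLp (fun ω => β (X 0 ω) (X 1 ω)) 2 P) {i j k l : ℕ} (hij : i ≠ j)
    (hkl : k ≠ l) (hik : i ≠ k) (hil : i ≠ l) :
    ∫ ω, β (X i ω) (X j ω) * β (X k ω) (X l ω) ∂P = 0 := by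
  let S : Finset ℕ := {j, k, l}
  have hS : Disjoint {i} S := by simp [S, hij, hik, hil]
  have hind := hX_indep.indepFun_finset {i} S hS hX_meas
  have hj : j ∈ S := by simp [S]
  have hk : k ∈ S := by simp [S]
  have hl : l ∈ S := by simp [S]
  have hind' : IndepFun (X i) (fun ω (m : S) => X m ω) P :=
    hind.comp (φ := fun v : ({i} : Finset ℕ) → 𝒳 => v ⟨i, Finset.mem_singleton_self i⟩) (ψ := id)
      (measurable_pi_apply _) measurable_id
  have hg_meas : Measurable fun w : S → 𝒳 => β (w ⟨k, hk⟩) (w ⟨l, hl⟩) := by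
    have : Measurable fun w : S → 𝒳 => (w ⟨k, hk⟩, w ⟨l, hl⟩) := by fun_prop
    exact hβ_meas.comp this
  refine integral_kernel_mul_eq_zero (F := F) (Y := X i) (W := fun ω (m : S) => X m ω)
    (u := fun w => w ⟨j, hj⟩) (g := fun w => β (w ⟨k, hk⟩) (w ⟨l, hl⟩)) (hX_meas i)
    (measurable_pi_lambda _ fun m => hX_meas m) (measurable_pi_apply _)
    hg_meas hind'
    (hX_law i) (hX_law j) hβ_meas hβ_symm hβ_zero ?_
  exact (memLp_kernel hX_meas hX_law hX_indep hβ_meas hβ_memLp hij).integrable_mul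
    (memLp_kernel hX_meas hX_law hX_indep hβ_meas hβ_memLp hkl)

/-- A degenerate kernel takes orthogonal values at distinct unordered pairs of observations. -/
theorem integral_kernel_mul_kernel_eq_zero (hX_meas : ∀ i, Measurable (X i))
    (hX_law : ∀ i, P.map (X i) = F) (hX_indep : iIndepFun X P)
    (hβ_meas : Measurable (Function.uncurry β)) (hβ_symm : ∀ x y, β x y = β y x)
    (hβ_zero : ∀ᵐ x ∂F, ∫ y, β x y ∂F = 0)
    (hβ_memLp : MemLp (fun ω => β (X 0 ω) (X 1 ω)) 2 P) {i j k l : ℕ} (hij : i ≠ j)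
    (hkl : k ≠ l) (h1 : ¬(i = k ∧ j = l)) (h2 : ¬(i = l ∧ j = k)) :
    ∫ ω, β (X i ω) (X j ω) * β (X k ω) (X l ω) ∂P = 0 := by
  by_cases hi : i ≠ k ∧ i ≠ l
  · exact integral_kernel_mul_kernel_eq_zero_of_ne hX_meas hX_law hX_indep hβ_meas hβ_symm hβ_zero
      hβ_memLp hij hkl hi.1 hi.2
  -- If `i` is shared by the two pairs then `j` is not; symmetry of `β` moves `j` to the first
  -- place.
  · simp_rw [fun ω => hβ_symm (X i ω) (X j ω)]
    exact integral_kernel_mul_kernel_eq_zero_of_ne hX_meas hX_law hX_indep hβ_meas hβ_symm hβ_zero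
      hβ_memLp hij.symm hkl (by omega) (by omega)

theorem integral_kernel_eq_zero (hX_meas : ∀ i, Measurable (X i))
    (hX_law : ∀ i, P.map (X i) = F) (hX_indep : iIndepFun X P)
    (hβ_meas : Measurable (Function.uncurry β)) (hβ_symm : ∀ x y, β x y = β y x)
    (hβ_zero : ∀ᵐ x ∂F, ∫ y, β x y ∂F = 0)
    (hβ_memLp : MemLp (fun ω => β (X 0 ω) (X 1 ω)) 2 P) {i j : ℕ} (hij : i ≠ j) :
    ∫ ω, β (X i ω) (X j ω) ∂P = 0 := by
  have hint := (memLp_kernel hX_meas hX_law hX_indep hβ_meas hβ_memLp hij).integrable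
    (by norm_num)
  have := integral_kernel_mul_eq_zero (F := F) (Y := X i) (W := X j) (u := id) (g := fun _ => 1)
    (hX_meas i) (hX_meas j) measurable_id measurable_const (hX_indep.indepFun hij) (hX_law i)
    (hX_law j) hβ_meas hβ_symm hβ_zero (by simpa using hint)
  simpa using this

/-- The variance of a weighted sum of a degenerate kernel over distinct unordered pairs. -/
theorem variance_sum_kernel (hX_meas : ∀ i, Measurable (X i))
    (hX_law : ∀ i, P.map (X i) = F) (hX_indep : iIndepFun X P)
    (hβ_meas : Measurable (Function.uncurry β)) (hβ_symm : ∀ x y, β x y = β y x)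
    (hβ_zero : ∀ᵐ x ∂F, ∫ y, β x y ∂F = 0)
    (hβ_memLp : MemLp (fun ω => β (X 0 ω) (X 1 ω)) 2 P) {ι : Type*} (s : Finset ι)
    (c : ι → ℝ) (a b : ι → ℕ) (hab : ∀ p ∈ s, a p ≠ b p)
    (hinj : ∀ p ∈ s, ∀ q ∈ s, a p = a q → b p = b q → p = q)
    (hswap : ∀ p ∈ s, ∀ q ∈ s, ¬(a p = b q ∧ b p = a q)) :
    Var[fun ω => ∑ p ∈ s, c p * β (X (a p) ω) (X (b p) ω); P]
      = (∑ p ∈ s, c p ^ 2) * Var[fun ω => β (X 0 ω) (X 1 ω); P] := by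
  have hL : ∀ p ∈ s, MemLp (fun ω => β (X (a p) ω) (X (b p) ω)) 2 P := fun p hp =>
    memLp_kernel hX_meas hX_law hX_indep hβ_meas hβ_memLp (hab p hp)
  rw [variance_fun_sum' fun p hp => (hL p hp).const_mul (c p), Finset.sum_mul]
  refine Finset.sum_congr rfl fun p hp => ?_
  rw [Finset.sum_eq_single_of_mem p hp]
  · rw [covariance_self ((hL p hp).const_mul (c p)).aestronglyMeasurable.aemeasurable,
      variance_const_mul, variance_kernel hX_meas hX_law hX_indep hβ_meas (hab p hp)]
  · intro q hq hqp
    rw [covariance_const_mul_left, covariance_const_mul_right, covariance_eq_sub (hL p hp) (hL q hq),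
      integral_kernel_eq_zero hX_meas hX_law hX_indep hβ_meas hβ_symm hβ_zero hβ_memLp (hab p hp)]
    have := integral_kernel_mul_kernel_eq_zero hX_meas hX_law hX_indep hβ_meas hβ_symm hβ_zero
      hβ_memLp (hab p hp) (hab q hq) (fun h => hqp (hinj p hp q hq h.1 h.2).symm)
      (hswap p hp q hq)
    simp [this]

end DegenerateKernel

/-! ### Algebra of block divisions -/

namespace BlockDivision

variable {N K : ℕ} (D : BlockDivision N K)

theorem sum_size : ∑ k, D.size k = N := by
  simpa using Fintype.card_congr D.index

theorem sum_size_cast : ∑ k, (D.size k : ℝ) = N := by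
  exact_mod_cast D.sum_size

theorem sum_block {𝒳 : Type*} (f : 𝒳 → ℝ) (x : Fin N → 𝒳) :
    ∑ k, ∑ i, f (D.block x k i) = ∑ i, f (x i) := by
  rw [← Equiv.sum_comp D.index, Fintype.sum_sigma]
  rfl

/-- Summing `c n_j ≤ n_k` over `j` shows that every block has size at least `c N / K`. -/
theorem mul_le_mul_size {c : ℝ} {k : Fin K} (h : ∀ j, c ≤ (D.size k : ℝ) / D.size j) :
    c * N ≤ K * D.size k := by
  have h1 : ∀ j, c * D.size j ≤ D.size k := by
    intro j
    rcases (Nat.cast_nonneg (α := ℝ) (D.size j)).eq_or_lt with h0 | h0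
    · rw [← h0, mul_zero]; positivity
    · exact (le_div_iff₀ h0).1 (h j)
  calc c * N = ∑ j, c * D.size j := by rw [← Finset.mul_sum, D.sum_size_cast]
    _ ≤ ∑ _j : Fin K, (D.size k : ℝ) := Finset.sum_le_sum fun j _ => h1 j
    _ = K * D.size k := by simp

/-- The division of a data set into a single block. -/
def single (N : ℕ) : BlockDivision N 1 where
  size := fun _ => N
  index := Equiv.uniqueSigma fun _ : Fin 1 => Fin N

theorem single_block {𝒳 : Type*} (x : Fin N → 𝒳) (k : Fin 1) : (single N).block x k = x := by
  obtain rfl := Subsingleton.elim k default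
  rfl

end BlockDivision

theorem sub_eq_add_remainder {N K : ℕ} {𝒳 : Type*} (D : BlockDivision N K) (hN : N ≠ 0)
    (S : (k : Fin K) → (Fin (D.size k) → 𝒳) → ℝ) (θ : ℝ) (α : 𝒳 → ℝ) (β : 𝒳 → 𝒳 → ℝ)
    (x : Fin N → 𝒳) :
    distributedStatistic D S x - θ = (N : ℝ)⁻¹ * (∑ i, α (x i)
      + ∑ k, ∑ i, ∑ j ∈ Finset.Ioi i, (D.size k : ℝ)⁻¹ * β (D.block x k i) (D.block x k j)
      + ∑ k, (D.size k : ℝ) * remainder θ α β (S k) (D.block x k)) := by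
  have hN' : (N : ℝ) ≠ 0 := by exact_mod_cast hN
  have h1 : ∀ k, (D.size k : ℝ) * S k (D.block x k) = D.size k * θ + ∑ i, α (D.block x k i)
      + ∑ i, ∑ j ∈ Finset.Ioi i, (D.size k : ℝ)⁻¹ * β (D.block x k i) (D.block x k j)
      + D.size k * remainder θ α β (S k) (D.block x k) := by
    intro k
    simp_rw [← Finset.mul_sum]
    -- Empty blocks are allowed here: their weight is zero and their sums are empty.
    rcases Nat.eq_zero_or_pos (D.size k) with h | h
    · have : IsEmpty (Fin (D.size k)) := by rw [h]; infer_instance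
      simp [h]
    · have : (D.size k : ℝ) ≠ 0 := by positivity
      rw [remainder]
      field_simp
      ring
  rw [distributedStatistic, Finset.sum_congr rfl fun k _ => h1 k]
  simp_rw [Finset.sum_add_distrib]
  rw [← Finset.sum_mul, D.sum_size_cast, D.sum_block]
  field_simp
  ring

/-! ### Negligibility of the quadratic terms and of the remainders -/

section BlockSums

variable {Ω 𝒳 : Type*} [MeasurableSpace Ω] [MeasurableSpace 𝒳] {P : Measure Ω}
  {F : Measure 𝒳} {X : ℕ → Ω → 𝒳} {α : 𝒳 → ℝ} {β : 𝒳 → 𝒳 → ℝ}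

theorem measurable_sample (hX_meas : ∀ i, Measurable (X i)) (N : ℕ) :
    Measurable (sample X N) :=
  measurable_pi_lambda _ fun i => hX_meas i

theorem measurable_block {N K : ℕ} (D : BlockDivision N K) (k : Fin K) :
    Measurable fun x : Fin N → 𝒳 => D.block x k :=
  measurable_pi_lambda _ fun _ => measurable_pi_apply _

theorem measurable_remainder (hα_meas : Measurable α) (hβ_meas : Measurable (Function.uncurry β))
    {m : ℕ} {S : (Fin m → 𝒳) → ℝ} (hS : Measurable S) (θ : ℝ) :
    Measurable (remainder θ α β S) := by
  have h : ∀ i j : Fin m, Measurable fun x : Fin m → 𝒳 => β (x i) (x j) := fun i j => by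
    have hij : Measurable fun x : Fin m → 𝒳 => (x i, x j) := by fun_prop
    exact hβ_meas.comp hij
  unfold remainder
  fun_prop

/-- Distinct blocks of an independent sample are independent. -/
theorem indepFun_block (hX_meas : ∀ i, Measurable (X i)) (hX_indep : iIndepFun X P) {N K : ℕ}
    (D : BlockDivision N K) {k l : Fin K} (hkl : k ≠ l) :
    IndepFun (fun ω => D.block (sample X N ω) k) (fun ω => D.block (sample X N ω) l) P := by
  let s : Fin K → Finset ℕ := fun k => Finset.univ.image fun i => (D.index ⟨k, i⟩ : ℕ)
  have hmem : ∀ k i, (D.index ⟨k, i⟩ : ℕ) ∈ s k := fun k i =>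
    Finset.mem_image_of_mem _ (Finset.mem_univ i)
  have hdisj : Disjoint (s k) (s l) := by
    rw [Finset.disjoint_left]
    intro m hm hm'
    simp only [s, Finset.mem_image, Finset.mem_univ, true_and] at hm hm'
    obtain ⟨i, rfl⟩ := hm
    obtain ⟨j, hj⟩ := hm'
    have := D.index.injective (Fin.ext hj)
    exact hkl (congrArg Sigma.fst this).symm
  have hm : ∀ k : Fin K, Measurable fun (v : s k → 𝒳) (i : Fin (D.size k)) =>
      v ⟨D.index ⟨k, i⟩, hmem k i⟩ := fun k =>
    measurable_pi_lambda _ fun _ => measurable_pi_apply _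
  exact (hX_indep.indepFun_finset (s k) (s l) hdisj hX_meas).comp (hm k) (hm l)

variable [IsProbabilityMeasure P]

/-- Orthogonality bounds the variance by a constant times `K / N`. The triple sum is flattened to
one sum over triples `(k, i, j)` with `i < j`, and `a`, `b` give the positions of the pair in the
full sample. -/
theorem tendstoInMeasure_block_kernel_sum (hX_meas : ∀ i, Measurable (X i))
    (hX_law : ∀ i, P.map (X i) = F) (hX_indep : iIndepFun X P)
    (hβ_meas : Measurable (Function.uncurry β)) (hβ_symm : ∀ x y, β x y = β y x)
    (hβ_memLp : MemLp (fun ω => β (X 0 ω) (X 1 ω)) 2 P)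
    (hβ_zero : ∀ᵐ x ∂F, ∫ y, β x y ∂F = 0) (K : ℕ → ℕ) (D : (N : ℕ) → BlockDivision N (K N))
    (hKN : Tendsto (fun N : ℕ => (K N : ℝ) / N) atTop (𝓝 0)) (c : ℝ) :
    TendstoInMeasure P (fun (N : ℕ) ω => (√(N : ℝ))⁻¹ * c * ∑ k, ∑ i, ∑ j ∈ Finset.Ioi i,
      ((D N).size k : ℝ)⁻¹
        * β ((D N).block (sample X N ω) k i) ((D N).block (sample X N ω) k j)) atTop 0 := by
  let s : (N : ℕ) → Finset (Σ k : Fin (K N), Σ _ : Fin ((D N).size k), Fin ((D N).size k)) :=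
    fun N => Finset.univ.sigma fun _ => Finset.univ.sigma fun i => Finset.Ioi i
  let a : (N : ℕ) → (Σ k : Fin (K N), Σ _ : Fin ((D N).size k), Fin ((D N).size k)) → ℕ :=
    fun N p => (D N).index ⟨p.1, p.2.1⟩
  let b : (N : ℕ) → (Σ k : Fin (K N), Σ _ : Fin ((D N).size k), Fin ((D N).size k)) → ℕ :=
    fun N p => (D N).index ⟨p.1, p.2.2⟩
  have hs : ∀ N p, p ∈ s N → p.2.1 < p.2.2 := by
    intro N p hp
    simpa [s] using hp
  have hsum : ∀ N ω, ∑ k, ∑ i, ∑ j ∈ Finset.Ioi i, ((D N).size k : ℝ)⁻¹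
        * β ((D N).block (sample X N ω) k i) ((D N).block (sample X N ω) k j)
      = ∑ p ∈ s N, ((D N).size p.1 : ℝ)⁻¹ * β (X (a N p) ω) (X (b N p) ω) := by
    intro N ω
    simp only [s, Finset.sum_sigma]
    rfl
  have hab : ∀ N, ∀ p ∈ s N, a N p ≠ b N p := by
    intro N p hp h
    have := (D N).index.injective (Fin.ext h)
    have h2 : p.2.1 = p.2.2 := by simpa using this
    exact (hs N p hp).ne h2
  have hinj : ∀ N, ∀ p ∈ s N, ∀ q ∈ s N, a N p = a N q → b N p = b N q → p = q := by
    rintro N ⟨k, i, j⟩ - ⟨k', i', j'⟩ - h1 h2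
    have h1' := (D N).index.injective (Fin.ext h1)
    have h2' := (D N).index.injective (Fin.ext h2)
    simp only [Sigma.mk.injEq] at h1' h2'
    obtain ⟨rfl, h1'⟩ := h1'
    obtain ⟨-, h2'⟩ := h2'
    rw [eq_of_heq h1', eq_of_heq h2']
  -- Two triples with swapped positions would lie in one block and give both `i < j` and `j < i`.
  have hswap : ∀ N, ∀ p ∈ s N, ∀ q ∈ s N, ¬(a N p = b N q ∧ b N p = a N q) := by
    rintro N ⟨k, i, j⟩ hp ⟨k', i', j'⟩ hq ⟨h1, h2⟩
    have h1' := (D N).index.injective (Fin.ext h1)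
    have h2' := (D N).index.injective (Fin.ext h2)
    simp only [Sigma.mk.injEq] at h1' h2'
    obtain ⟨rfl, h1'⟩ := h1'
    obtain ⟨-, h2'⟩ := h2'
    rw [eq_of_heq h1', eq_of_heq h2'] at hp
    exact lt_asymm (hs N _ hp) (hs N _ hq)
  have hL : ∀ N, ∀ p ∈ s N, MemLp (fun ω => β (X (a N p) ω) (X (b N p) ω)) 2 P := fun N p hp =>
    memLp_kernel hX_meas hX_law hX_indep hβ_meas hβ_memLp (hab N p hp)
  have hcoef : ∀ N, ∑ p ∈ s N, ((D N).size p.1 : ℝ)⁻¹ ^ 2 ≤ K N := by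
    intro N
    simp only [s, Finset.sum_sigma]
    calc ∑ k, ∑ i, ∑ j ∈ Finset.Ioi i, ((D N).size k : ℝ)⁻¹ ^ 2
        ≤ ∑ k, ∑ _i : Fin ((D N).size k), ∑ _j : Fin ((D N).size k),
            ((D N).size k : ℝ)⁻¹ ^ 2 :=
          Finset.sum_le_sum fun k _ => Finset.sum_le_sum fun i _ =>
            Finset.sum_le_sum_of_subset_of_nonneg (Finset.subset_univ _)
              fun _ _ _ => sq_nonneg _
      _ ≤ ∑ _k : Fin (K N), (1 : ℝ) := Finset.sum_le_sum fun k _ => by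
          simp only [Finset.sum_const, Finset.card_univ, Fintype.card_fin, nsmul_eq_mul]
          rcases eq_or_ne ((D N).size k : ℝ) 0 with h | h
          · simp [h]
          · apply le_of_eq
            field_simp
      _ = K N := by simp
  simp_rw [hsum]
  set V := Var[fun ω => β (X 0 ω) (X 1 ω); P] with hV
  have hV0 : 0 ≤ V := variance_nonneg _ _
  refine tendstoInMeasure_zero_of_mean_of_variance (Eventually.of_forall fun N => ?_) ?_ ?_
  · exact (memLp_finsetSum _ fun p hp => (hL N p hp).const_mul _).const_mul _
  · refine tendsto_const_nhds.congr fun N => ?_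
    rw [integral_const_mul, integral_finsetSum _ fun p hp =>
      (((hL N p hp).integrable (by norm_num)).const_mul _), Finset.sum_eq_zero, mul_zero]
    intro p hp
    rw [integral_const_mul, integral_kernel_eq_zero hX_meas hX_law hX_indep hβ_meas hβ_symm
      hβ_zero hβ_memLp (hab N p hp), mul_zero]
  · have hlim : Tendsto (fun N : ℕ => c ^ 2 * V * ((K N : ℝ) / N)) atTop (𝓝 0) := by
      simpa using hKN.const_mul (c ^ 2 * V)
    refine squeeze_zero (fun N => variance_nonneg _ _) (fun N => ?_) hlim
    rw [variance_const_mul, variance_sum_kernel hX_meas hX_law hX_indep hβ_meas hβ_symm hβ_zero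
      hβ_memLp (s N) _ (a N) (b N) (hab N) (hinj N) (hswap N), ← hV, mul_pow, inv_pow,
      Real.sq_sqrt (Nat.cast_nonneg N)]
    calc (N : ℝ)⁻¹ * c ^ 2 * ((∑ p ∈ s N, ((D N).size p.1 : ℝ)⁻¹ ^ 2) * V)
        ≤ (N : ℝ)⁻¹ * c ^ 2 * (K N * V) := by
          gcongr
          exact hcoef N
      _ = c ^ 2 * V * ((K N : ℝ) / N) := by ring

/-- The accumulated bias of the blocks is negligible on the scale `√N` when there are few
blocks. -/
theorem tendsto_inv_sqrt_mul_sum_size_rpow {K : ℕ → ℕ} {D : (N : ℕ) → BlockDivision N (K N)}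
    {c τ τ' : ℝ} (hc : 0 < c)
    (hsize : ∀ᶠ N in atTop, ∀ k j : Fin (K N), c ≤ ((D N).size k : ℝ) / (D N).size j)
    (hτ : 1 ≤ τ) (hτ' : τ' < 1 - 1 / (2 * τ))
    (hK : (fun N : ℕ => (K N : ℝ)) =O[atTop] fun N : ℕ => (N : ℝ) ^ τ') :
    Tendsto (fun N : ℕ => (√(N : ℝ))⁻¹ * ∑ k, ((D N).size k : ℝ) * ((D N).size k : ℝ) ^ (-τ))
      atTop (𝓝 0) := by
  obtain ⟨C, hC0, hC⟩ := hK.exists_pos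
  have hτ0 : 0 < τ := by linarith
  -- Minus the exponent of `N` in `N ^ (-1/2) * K ^ τ * N ^ (1 - τ)` for `K` of order `N ^ τ'`; it
  -- is positive exactly when `τ' < 1 - 1 / (2 τ)`.
  have hexp : 0 < τ - 1 / 2 - τ' * τ := by
    have h := mul_lt_mul_of_pos_right hτ' hτ0
    have h2 : 1 / (2 * τ) * τ = 1 / 2 := by field_simp
    rw [sub_mul, h2] at h
    linarith
  have hlim : Tendsto (fun N : ℕ => c ^ (1 - τ) * C ^ τ * (N : ℝ) ^ (-(τ - 1 / 2 - τ' * τ)))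
      atTop (𝓝 0) := by
    simpa using ((tendsto_rpow_neg_atTop hexp).comp tendsto_natCast_atTop_atTop).const_mul
      (c ^ (1 - τ) * C ^ τ)
  refine squeeze_zero' (Eventually.of_forall fun N => by positivity) ?_ hlim
  filter_upwards [hsize, hC.bound, eventually_gt_atTop 0] with N hN hKN hNpos
  have hN0 : (0 : ℝ) < N := by exact_mod_cast hNpos
  have hKN' : (K N : ℝ) ≤ C * (N : ℝ) ^ τ' := by
    simpa [abs_of_nonneg (Real.rpow_nonneg hN0.le τ')] using hKN
  have hpowK : (K N : ℝ) ^ τ ≤ C ^ τ * (N : ℝ) ^ (τ' * τ) := by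
    rw [Real.rpow_mul hN0.le, ← Real.mul_rpow hC0.le (by positivity)]
    exact Real.rpow_le_rpow (Nat.cast_nonneg _) hKN' hτ0.le
  have hsum : ∑ k, ((D N).size k : ℝ) * ((D N).size k : ℝ) ^ (-τ)
      ≤ (K N : ℝ) ^ τ * (c ^ (1 - τ) * (N : ℝ) ^ (1 - τ)) := by
    calc ∑ k, ((D N).size k : ℝ) * ((D N).size k : ℝ) ^ (-τ)
        ≤ ∑ _k : Fin (K N), (c * N / K N) ^ (1 - τ) := Finset.sum_le_sum fun k _ => by
          have hK0 : (0 : ℝ) < K N := by exact_mod_cast Fin.pos k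
          have hle : c * N / K N ≤ (D N).size k := by
            rw [div_le_iff₀ hK0, mul_comm ((D N).size k : ℝ)]
            exact (D N).mul_le_mul_size (hN k)
          have hb0 : 0 < c * N / K N := by positivity
          have hn0 := hb0.trans_le hle
          have hmul : ((D N).size k : ℝ) * ((D N).size k : ℝ) ^ (-τ)
              = ((D N).size k : ℝ) ^ (1 - τ) := by
            rw [sub_eq_add_neg, Real.rpow_add hn0, Real.rpow_one]
          rw [hmul]
          exact Real.rpow_le_rpow_of_nonpos hb0 hle (by linarith)
      _ = K N * (c * N / K N) ^ (1 - τ) := by simp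
      _ = (K N : ℝ) ^ τ * (c ^ (1 - τ) * (N : ℝ) ^ (1 - τ)) := by
          rcases (Nat.cast_nonneg (α := ℝ) (K N)).eq_or_lt with h | h
          · rw [← h, Real.zero_rpow hτ0.ne']; simp
          · rw [Real.div_rpow (by positivity) h.le, Real.mul_rpow hc.le hN0.le, Real.rpow_sub h,
              Real.rpow_one]
            field_simp
  have hsqrt : (√(N : ℝ))⁻¹ = (N : ℝ) ^ (-(1 / 2) : ℝ) := by
    rw [Real.rpow_neg hN0.le, Real.sqrt_eq_rpow]
  calc (√(N : ℝ))⁻¹ * ∑ k, ((D N).size k : ℝ) * ((D N).size k : ℝ) ^ (-τ)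
      ≤ (N : ℝ) ^ (-(1 / 2) : ℝ)
          * (C ^ τ * (N : ℝ) ^ (τ' * τ) * (c ^ (1 - τ) * (N : ℝ) ^ (1 - τ))) := by
        rw [hsqrt]
        gcongr
        exact hsum.trans (by gcongr)
    _ = c ^ (1 - τ) * C ^ τ
          * ((N : ℝ) ^ (-(1 / 2) : ℝ) * (N : ℝ) ^ (τ' * τ) * (N : ℝ) ^ (1 - τ)) := by ring
    _ = c ^ (1 - τ) * C ^ τ * (N : ℝ) ^ (-(τ - 1 / 2 - τ' * τ)) := by
        rw [← Real.rpow_add hN0, ← Real.rpow_add hN0]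
        ring_nf

/-- Biases accumulate over the blocks, while independence makes only the variances add. The former
is what limits the growth of `K`. -/
theorem tendstoInMeasure_block_remainder_sum (hX_meas : ∀ i, Measurable (X i))
    (hX_indep : iIndepFun X P) (hα_meas : Measurable α)
    (hβ_meas : Measurable (Function.uncurry β)) {K : ℕ → ℕ}
    {D : (N : ℕ) → BlockDivision N (K N)}
    {S : (N : ℕ) → (k : Fin (K N)) → (Fin ((D N).size k) → 𝒳) → ℝ}
    (hS : ∀ N k, IsSymmetricStatistic (S N k)) {θ c τ₁ τ₂ τ' : ℝ} (hc : 0 < c)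
    (hsize : ∀ᶠ N in atTop, ∀ k j : Fin (K N), c ≤ ((D N).size k : ℝ) / (D N).size j)
    (hτ₁ : 1 ≤ τ₁) (hτ₂ : 1 < τ₂) (hτ' : τ' < 1 - 1 / (2 * τ₁))
    (hK : (fun N : ℕ => (K N : ℝ)) =O[atTop] fun N : ℕ => (N : ℝ) ^ τ')
    {b : (N : ℕ) → Fin (K N) → ℝ}
    (hR : BlockRemainderMoments P (fun N => (D N).size)
      (fun N k ω => remainder θ α β (S N k) ((D N).block (sample X N ω) k)) b τ₁ τ₂) (a : ℝ) :
    TendstoInMeasure P (fun (N : ℕ) ω => (√(N : ℝ))⁻¹ * a * ∑ k, ((D N).size k : ℝ)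
      * remainder θ α β (S N k) ((D N).block (sample X N ω) k)) atTop 0 := by
  let R : (N : ℕ) → Fin (K N) → Ω → ℝ := fun N k ω =>
    remainder θ α β (S N k) ((D N).block (sample X N ω) k)
  obtain ⟨B, hB⟩ := hR.bounded
  refine tendstoInMeasure_zero_of_mean_of_variance ?_ ?_ ?_
  · filter_upwards [hR.memLp] with N hN
    exact (memLp_finsetSum _ fun k _ => (hN k).const_mul _).const_mul _
  · have hlim := (tendsto_inv_sqrt_mul_sum_size_rpow hc hsize hτ₁ hτ' hK).const_mul
      (|a| * (B + 1))
    rw [mul_zero] at hlim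
    refine squeeze_zero_norm' ?_ hlim
    filter_upwards [hR.memLp, hR.mean 1 one_pos] with N hN hmean
    rw [integral_const_mul, integral_finsetSum _ fun k _ =>
      ((hN k).integrable (by norm_num)).const_mul _]
    have hterm : ∀ k, |∫ ω, ((D N).size k : ℝ) * R N k ω ∂P|
        ≤ (B + 1) * (((D N).size k : ℝ) * ((D N).size k : ℝ) ^ (-τ₁)) := by
      intro k
      have hp : 0 ≤ ((D N).size k : ℝ) ^ (-τ₁) := by positivity
      have h1 : |∫ ω, R N k ω ∂P| ≤ (B + 1) * ((D N).size k : ℝ) ^ (-τ₁) := by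
        have h2 := abs_sub_abs_le_abs_sub (∫ ω, R N k ω ∂P) (b N k * ((D N).size k : ℝ) ^ (-τ₁))
        have h3 := mul_le_mul_of_nonneg_right (hB N k) hp
        have h4 := hmean k
        rw [abs_mul, abs_of_nonneg hp] at h2
        change |(∫ ω, R N k ω ∂P) - _| ≤ _ at h4
        linarith
      rw [integral_const_mul, abs_mul, Nat.abs_cast]
      calc ((D N).size k : ℝ) * |∫ ω, R N k ω ∂P|
          ≤ (D N).size k * ((B + 1) * ((D N).size k : ℝ) ^ (-τ₁)) := by gcongr
        _ = _ := by ring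
    rw [Real.norm_eq_abs, abs_mul, abs_mul, abs_of_nonneg (by positivity : 0 ≤ (√(N : ℝ))⁻¹)]
    calc (√(N : ℝ))⁻¹ * |a| * |∑ k, ∫ ω, ((D N).size k : ℝ) * R N k ω ∂P|
        ≤ (√(N : ℝ))⁻¹ * |a|
            * ∑ k, (B + 1) * (((D N).size k : ℝ) * ((D N).size k : ℝ) ^ (-τ₁)) := by
          gcongr
          exact (Finset.abs_sum_le_sum_abs _ _).trans (Finset.sum_le_sum fun k _ => hterm k)
      _ = _ := by rw [← Finset.mul_sum]; ring
  · rw [Metric.tendsto_nhds]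
    intro ε hε
    -- The `+ 1` covers `a = 0`, and the factor `2` makes the final inequality strict.
    have hε' : 0 < ε / (2 * (a ^ 2 + 1)) := by positivity
    filter_upwards [hR.memLp, hR.variance _ hε', hsize, eventually_gt_atTop 0]
      with N hN hvar hsz hNpos
    have hN0 : (0 : ℝ) < N := by exact_mod_cast hNpos
    have hpair : ∀ k l : Fin (K N), k ≠ l → IndepFun (fun ω => ((D N).size k : ℝ) * R N k ω)
        (fun ω => ((D N).size l : ℝ) * R N l ω) P := fun k l hkl =>
      (indepFun_block hX_meas hX_indep (D N) hkl).comp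
        (φ := fun x => ((D N).size k : ℝ) * remainder θ α β (S N k) x)
        (ψ := fun x => ((D N).size l : ℝ) * remainder θ α β (S N l) x)
        ((measurable_remainder hα_meas hβ_meas (hS N k).measurable θ).const_mul _)
        ((measurable_remainder hα_meas hβ_meas (hS N l).measurable θ).const_mul _)
    have hvarsum : Var[fun ω => ∑ k, ((D N).size k : ℝ) * R N k ω; P]
        = ∑ k, ((D N).size k : ℝ) ^ 2 * Var[R N k; P] := by
      have h := IndepFun.variance_sum (μ := P) (s := Finset.univ)
        (X := fun k ω => ((D N).size k : ℝ) * R N k ω) (fun k _ => (hN k).const_mul _)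
        (fun k _ l _ hkl => hpair k l hkl)
      simp_rw [variance_const_mul] at h
      rw [← h]
      congr 1
      ext ω
      simp
    have hterm : ∀ k, ((D N).size k : ℝ) ^ 2 * Var[R N k; P]
        ≤ ε / (2 * (a ^ 2 + 1)) * (D N).size k := by
      intro k
      -- An empty block would have the ratio `0 / 0 = 0` to itself, against `0 < c`.
      have hn1 : 1 ≤ (D N).size k := by
        rw [Nat.one_le_iff_ne_zero]
        intro h0
        have := hsz k k
        rw [h0] at this
        norm_num at this
        linarith
      have hn1' : (1 : ℝ) ≤ (D N).size k := by exact_mod_cast hn1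
      have hpow : ((D N).size k : ℝ) ^ (-τ₂) ≤ ((D N).size k : ℝ)⁻¹ := by
        rw [← Real.rpow_neg_one]
        exact Real.rpow_le_rpow_of_exponent_le hn1' (by linarith)
      calc ((D N).size k : ℝ) ^ 2 * Var[R N k; P]
          ≤ ((D N).size k : ℝ) ^ 2 * (ε / (2 * (a ^ 2 + 1)) * ((D N).size k : ℝ)⁻¹) := by
            gcongr
            exact (hvar k).trans (by gcongr)
        _ = ε / (2 * (a ^ 2 + 1)) * (D N).size k := by
            have : ((D N).size k : ℝ) ≠ 0 := by positivity
            field_simp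
    rw [Real.dist_0_eq_abs, abs_of_nonneg (variance_nonneg _ _), variance_const_mul]
    change _ * Var[fun ω => ∑ k, ((D N).size k : ℝ) * R N k ω; P] < ε
    rw [hvarsum, mul_pow, inv_pow, Real.sq_sqrt hN0.le]
    calc (N : ℝ)⁻¹ * a ^ 2 * ∑ k, ((D N).size k : ℝ) ^ 2 * Var[R N k; P]
        ≤ (N : ℝ)⁻¹ * a ^ 2 * ∑ k, ε / (2 * (a ^ 2 + 1)) * (D N).size k := 
          mul_le_mul_of_nonneg_left (Finset.sum_le_sum fun k _ => hterm k) (by positivity)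
      _ = a ^ 2 / (a ^ 2 + 1) * (ε / 2) := by
          rw [← Finset.mul_sum, (D N).sum_size_cast]
          field_simp
      _ ≤ 1 * (ε / 2) := by
          gcongr
          rw [div_le_one (by positivity)]
          linarith
      _ < ε := by linarith

end BlockSums

/-! ### The full sample as a single block -/

theorem distributedStatistic_single {𝒳 : Type*} {N : ℕ} (hN : N ≠ 0) (T : (Fin N → 𝒳) → ℝ)
    (x : Fin N → 𝒳) :
    distributedStatistic (BlockDivision.single N) (fun _ => T) x = T x := by
  have hN' : (N : ℝ) ≠ 0 := by exact_mod_cast hN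
  simp only [distributedStatistic, BlockDivision.single_block]
  simp [BlockDivision.single, hN']

theorem RemainderMoments.single {Ω : Type*} [MeasurableSpace Ω] {P : Measure Ω}
    {R : ℕ → Ω → ℝ} {b τ₁ τ₂ : ℝ}
    (h : RemainderMoments P R b τ₁ τ₂) :
    BlockRemainderMoments P (K := fun _ => 1) (fun N => (BlockDivision.single N).size)
      (fun N _ => R N) (fun _ _ => b) τ₁ τ₂ where
  memLp := h.memLp.mono fun _ hN _ => hN
  bounded := ⟨|b|, fun _ _ => le_rfl⟩
  mean ε hε := (h.mean.bound hε).mono fun N hN _ => by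
    rwa [Real.norm_eq_abs, Real.norm_of_nonneg (by positivity)] at hN
  variance ε hε := (h.variance.bound hε).mono fun N hN _ => by
    rw [Real.norm_of_nonneg (variance_nonneg _ _), Real.norm_of_nonneg (by positivity)] at hN
    exact hN

/-! ### Asymptotic normality and the conclusion -/

section AsymptoticNormality

variable {Ω 𝒳 : Type*} [MeasurableSpace Ω] [MeasurableSpace 𝒳] {P : Measure Ω}
  [IsProbabilityMeasure P] {F : Measure 𝒳} {X : ℕ → Ω → 𝒳} {α : 𝒳 → ℝ} {β : 𝒳 → 𝒳 → ℝ}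

theorem tendstoInDistribution_standardized_sum (hX_meas : ∀ i, Measurable (X i))
    (hX_law : ∀ i, P.map (X i) = F) (hX_indep : iIndepFun X P) (hα_meas : Measurable α)
    (hα_mean : ∫ ω, α (X 0 ω) ∂P = 0) {σ : ℝ}
    (hα_var : Var[fun ω => α (X 0 ω); P] = σ ^ 2) (hσ : 0 < σ) :
    TendstoInDistribution (fun (N : ℕ) ω => (√(N : ℝ))⁻¹ * ∑ i ∈ Finset.range N,
      σ⁻¹ * α (X i ω)) atTop id (fun _ => P) (gaussianReal 0 1) := by
  have hf : Measurable fun x => σ⁻¹ * α x := hα_meas.const_mul _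
  refine tendstoInDistribution_inv_sqrt_mul_sum (X := fun i ω => σ⁻¹ * α (X i ω)) HasLaw.id ?_ ?_
    (hX_indep.comp (fun _ x => σ⁻¹ * α x) fun _ => hf) fun i => ?_
  · rw [integral_const_mul, hα_mean, mul_zero]
  · rw [variance_of_integral_eq_zero (X := fun ω => α (X 0 ω)) (hα_meas.comp (hX_meas 0)).aemeasurable hα_mean] at hα_var
    simp only [Pi.pow_apply, mul_pow]
    rw [integral_const_mul, hα_var]
    field_simp
  · have h : IdentDistrib (X i) (X 0) P P :=
      ⟨(hX_meas i).aemeasurable, (hX_meas 0).aemeasurable, by rw [hX_law, hX_law]⟩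
    exact h.comp hf

/-- The distributed statistic is asymptotically normal. -/
theorem tendstoInDistribution_distributedStatistic (hX_meas : ∀ i, Measurable (X i))
    (hX_law : ∀ i, P.map (X i) = F) (hX_indep : iIndepFun X P) (hα_meas : Measurable α)
    (hα_mean : ∫ ω, α (X 0 ω) ∂P = 0) {σ : ℝ}
    (hα_var : Var[fun ω => α (X 0 ω); P] = σ ^ 2) (hσ : 0 < σ)
    (hβ_meas : Measurable (Function.uncurry β)) (hβ_symm : ∀ x y, β x y = β y x)
    (hβ_memLp : MemLp (fun ω => β (X 0 ω) (X 1 ω)) 2 P)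
    (hβ_zero : ∀ᵐ x ∂F, ∫ y, β x y ∂F = 0) {K : ℕ → ℕ} {D : (N : ℕ) → BlockDivision N (K N)}
    (hKN : Tendsto (fun N : ℕ => (K N : ℝ) / N) atTop (𝓝 0))
    {S : (N : ℕ) → (k : Fin (K N)) → (Fin ((D N).size k) → 𝒳) → ℝ}
    (hS : ∀ N k, IsSymmetricStatistic (S N k)) {θ c τ₁ τ₂ τ' : ℝ} (hc : 0 < c)
    (hsize : ∀ᶠ N in atTop, ∀ k j : Fin (K N), c ≤ ((D N).size k : ℝ) / (D N).size j)
    (hτ₁ : 1 ≤ τ₁) (hτ₂ : 1 < τ₂) (hτ' : τ' < 1 - 1 / (2 * τ₁))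
    (hK : (fun N : ℕ => (K N : ℝ)) =O[atTop] fun N : ℕ => (N : ℝ) ^ τ')
    {b : (N : ℕ) → Fin (K N) → ℝ}
    (hR : BlockRemainderMoments P (fun N => (D N).size)
      (fun N k ω => remainder θ α β (S N k) ((D N).block (sample X N ω) k)) b τ₁ τ₂) :
    TendstoInDistribution
      (fun (N : ℕ) ω => √(N : ℝ) * σ⁻¹ * (distributedStatistic (D N) (S N) (sample X N ω) - θ))
      atTop id (fun _ => P) (gaussianReal 0 1) := by
  refine tendstoInDistribution_of_tendstoInMeasure_sub _ _
    (tendstoInDistribution_standardized_sum hX_meas hX_law hX_indep hα_meas hα_mean hα_var hσ)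
    ?_ fun N => ?_
  · convert (tendstoInMeasure_block_kernel_sum hX_meas hX_law hX_indep hβ_meas hβ_symm hβ_memLp
      hβ_zero K D hKN σ⁻¹).add_zero_limits (tendstoInMeasure_block_remainder_sum hX_meas hX_indep
      hα_meas hβ_meas hS hc hsize hτ₁ hτ₂ hτ' hK hR σ⁻¹) using 1
    ext N ω
    simp only [Pi.sub_apply, Pi.add_apply]
    rcases eq_or_ne N 0 with rfl | hN
    · simp
    · have hsqrt : √(N : ℝ) * (N : ℝ)⁻¹ = (√(N : ℝ))⁻¹ := by
        rw [← div_eq_mul_inv, Real.sqrt_div_self]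
      have hsum : ∑ i ∈ Finset.range N, σ⁻¹ * α (X i ω) = σ⁻¹ * ∑ i, α (sample X N ω i) := by
        rw [← Finset.mul_sum]
        congr 1
        exact (Fin.sum_univ_eq_sum_range (fun i => α (X i ω)) N).symm
      rw [sub_eq_add_remainder (D N) hN (S N) θ α β, hsum, ← hsqrt]
      ring
  · have h : Measurable (distributedStatistic (D N) (S N)) :=
      (Finset.measurable_sum _ fun k _ =>
        ((hS N k).measurable.comp (measurable_block (D N) k)).const_mul _).const_mul _
    exact (((h.comp (measurable_sample hX_meas N)).sub_const θ).const_mul _).aemeasurable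

/-- The full-sample statistic is asymptotically normal: it is the distributed statistic of a
single block. -/
theorem tendstoInDistribution_statistic (hX_meas : ∀ i, Measurable (X i))
    (hX_law : ∀ i, P.map (X i) = F) (hX_indep : iIndepFun X P) (hα_meas : Measurable α)
    (hα_mean : ∫ ω, α (X 0 ω) ∂P = 0) {σ : ℝ}
    (hα_var : Var[fun ω => α (X 0 ω); P] = σ ^ 2) (hσ : 0 < σ)
    (hβ_meas : Measurable (Function.uncurry β)) (hβ_symm : ∀ x y, β x y = β y x)
    (hβ_memLp : MemLp (fun ω => β (X 0 ω) (X 1 ω)) 2 P)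
    (hβ_zero : ∀ᵐ x ∂F, ∫ y, β x y ∂F = 0) {T : (N : ℕ) → (Fin N → 𝒳) → ℝ}
    (hT : ∀ N, IsSymmetricStatistic (T N)) {θ b τ₁ τ₂ : ℝ} (hτ₁ : 1 ≤ τ₁) (hτ₂ : 1 < τ₂)
    (hR : RemainderMoments P (fun N ω => remainder θ α β (T N) (sample X N ω)) b τ₁ τ₂) :
    TendstoInDistribution (fun (N : ℕ) ω => √(N : ℝ) * σ⁻¹ * (T N (sample X N ω) - θ))
      atTop id (fun _ => P) (gaussianReal 0 1) := by
  have hτ : 0 < 1 - 1 / (2 * τ₁) := by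
    rw [sub_pos, div_lt_one (by positivity)]
    linarith
  have hKN : Tendsto (fun N : ℕ => ((1 : ℕ) : ℝ) / N) atTop (𝓝 0) :=
    tendsto_const_div_atTop_nhds_zero_nat _
  have hsize : ∀ᶠ N in atTop, ∀ k j : Fin 1,
      (1 : ℝ) ≤ ((BlockDivision.single N).size k : ℝ) / (BlockDivision.single N).size j := by
    filter_upwards [eventually_ne_atTop 0] with N hN k j
    have hN' : (N : ℝ) ≠ 0 := by exact_mod_cast hN
    simp [BlockDivision.single, hN']
  -- One block corresponds to growth exponent `0`, which is admissible because `τ₁ ≥ 1`.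
  have hK : (fun _ : ℕ => ((1 : ℕ) : ℝ)) =O[atTop] fun N : ℕ => (N : ℝ) ^ (0 : ℝ) := by
    simp_rw [Real.rpow_zero, Nat.cast_one]
    exact isBigO_refl _ _
  have h := tendstoInDistribution_distributedStatistic (K := fun _ => 1)
    (D := fun N => BlockDivision.single N) (S := fun N _ => T N) hX_meas hX_law hX_indep hα_meas
    hα_mean hα_var hσ hβ_meas hβ_symm hβ_memLp hβ_zero hKN (fun N _ => hT N) one_pos hsize hτ₁ hτ₂
    hτ hK (b := fun _ _ => b) (θ := θ)
    (by simp only [BlockDivision.single_block]; exact hR.single)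
  refine h.congr (fun N => Eventually.of_forall fun ω => ?_) (ae_eq_refl _)
  -- For `N = 0` the two statistics may differ, but the factor `√N` makes both sides zero.
  rcases eq_or_ne N 0 with rfl | hN
  · simp
  · simp only [distributedStatistic_single hN]

end AsymptoticNormality

theorem theorem4
    {Ω 𝒳 : Type*} [MeasurableSpace Ω] [MeasurableSpace 𝒳]
    (P : Measure Ω) [IsProbabilityMeasure P]
    -- the data: independent with common distribution `F`
    (F : Measure 𝒳) (X : ℕ → Ω → 𝒳)
    (hX_meas : ∀ i, Measurable (X i))
    (hX_law : ∀ i, P.map (X i) = F)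
    (hX_indep : iIndepFun X P)
    -- the full-sample statistics and the parameter
    (θ : ℝ) (T : (N : ℕ) → (Fin N → 𝒳) → ℝ)
    (hT : ∀ N, IsSymmetricStatistic (T N))
    -- condition on `α` and `β`
    (α : 𝒳 → ℝ) (β : 𝒳 → 𝒳 → ℝ) (σ : ℝ)
    (hα_meas : Measurable α)
    (hα_memLp : MemLp (fun ω => α (X 0 ω)) 2 P)
    (hα_mean : ∫ ω, α (X 0 ω) ∂P = 0)
    (hα_var : variance (fun ω => α (X 0 ω)) P = σ ^ 2)
    (hβ_meas : Measurable (Function.uncurry β))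
    (hβ_symm : ∀ x y, β x y = β y x)
    (hβ_memLp : MemLp (fun ω => β (X 0 ω) (X 1 ω)) 2 P)
    (hβ_cond : P[fun ω => β (X 0 ω) (X 1 ω) | MeasurableSpace.comap (X 0) inferInstance] =ᵐ[P] 0)
    -- non-degeneracy
    (hσ : 0 < σ)
    -- moment condition on `α`
    (δ : ℝ) (hδ_pos : 0 < δ) (hδ_le : δ ≤ 1)
    (hα_moment : Integrable (fun ω => |α (X 0 ω)| ^ (2 + δ)) P)
    -- division of the data into `K N` blocks of comparable sizes
    (K : ℕ → ℕ) (D : (N : ℕ) → BlockDivision N (K N))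
    (c₁ c₂ : ℝ) (hc₁ : 0 < c₁) (hc₂ : 0 < c₂)
    (hsize : ∀ᶠ N in atTop, ∀ k₁ k₂ : Fin (K N),
      c₁ ≤ ((D N).size k₁ : ℝ) / (D N).size k₂ ∧ ((D N).size k₁ : ℝ) / (D N).size k₂ ≤ c₂)
    (hKN : Tendsto (fun N : ℕ => (K N : ℝ) / N) atTop (𝓝 0))
    -- the block-wise statistics
    (S : (N : ℕ) → (k : Fin (K N)) → (Fin ((D N).size k) → 𝒳) → ℝ)
    (hS : ∀ N k, IsSymmetricStatistic (S N k))
    -- moments of the remainders of the full-sample and of the block-wise statistics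
    (τ₁ τ₂ b₁ : ℝ) (hτ₁ : 1 ≤ τ₁) (hτ₂ : 1 < τ₂)
    (hR : RemainderMoments P (fun N ω => remainder θ α β (T N) (sample X N ω)) b₁ τ₁ τ₂)
    (b : (N : ℕ) → Fin (K N) → ℝ)
    (hRblock : BlockRemainderMoments P (fun N => (D N).size)
      (fun N k ω => remainder θ α β (S N k) ((D N).block (sample X N ω) k)) b τ₁ τ₂)
    -- growth of the number of blocks
    (τ' : ℝ) (hτ'_pos : 0 < τ') (hτ'_lt : τ' < 1 - 1 / (2 * τ₁))
    (hK : (fun N : ℕ => (K N : ℝ)) =O[atTop] fun N : ℕ => (N : ℝ) ^ τ') :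
    Tendsto
      (fun N : ℕ => kolmogorovDist P
        (fun ω => √(N : ℝ) * σ⁻¹ * (distributedStatistic (D N) (S N) (sample X N ω) - θ))
        (fun ω => √(N : ℝ) * σ⁻¹ * (T N (sample X N ω) - θ)))
      atTop (𝓝 0) := by
  have hβ_zero := ae_integral_kernel_eq_zero hX_meas hX_law hX_indep hβ_meas hβ_memLp hβ_cond
  have : NullSingletonClass (Measure.map id (gaussianReal 0 1)) := by
    rw [Measure.map_id]
    exact nullSingletonClass_gaussianReal one_ne_zero
  exact tendsto_kolmogorovDist_zero
    (tendstoInDistribution_distributedStatistic hX_meas hX_law hX_indep hα_meas hα_mean hα_var hσ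
      hβ_meas hβ_symm hβ_memLp hβ_zero hKN hS hc₁ (hsize.mono fun N h k j => (h k j).1) hτ₁ hτ₂
      hτ'_lt hK hRblock)
    (tendstoInDistribution_statistic hX_meas hX_law hX_indep hα_meas hα_mean hα_var hσ hβ_meas
      hβ_symm hβ_memLp hβ_zero hT hτ₁ hτ₂ hR)
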